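/- Let $X$ be a complex manifold of dimension $n$ (for instance a compact Kähler manifold; neither compactness nor a Kähler metric is needed), let $\mathcal O$ be its sheaf of holomorphic functions, let $\mathcal E$ be a locally free $\mathcal O$-module of finite rank and let $\mathcal G$ be a coherent $\mathcal O$-module. For $\mathcal O$-modules $\mathcal F,\mathcal G$, let $\mathcal Hom(\mathcal F,\mathcal G)$ be the sheaf of complex vector spaces $U\mapsto \mathrm{Hom}_{\mathcal O|_U}(\mathcal F|_U,\mathcal G|_U)$. Let $\mathcal Ext^k(\mathcal F,\cdot)$ be the $k$-th right derived functor of $\mathcal Hom(\mathcal F,\cdot)$ from $\mathcal O$-modules to sheaves of complex vector spaces, and let $\mathit{Ext}^k(\mathcal F,\mathcal G)=\mathrm{Hom}_{D(\mathcal O)}(\mathcal F,\mathcal G[k])$ be the $k$-th Ext group in the category of $\mathcal O$-modules, where $D(\mathcal O)$ is the derived category of $\mathcal O$-modules. The space of vertex operators for strings of ghost number $k$ from $\mathcal F$ to $\mathcal G$ is $\bigoplus_q H^q(X,\mathcal Ext^k(\mathcal F,\mathcal G))$. (1) For every $k>0$ the sheaf $\mathcal Ext^k(\mathcal E,\mathcal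 G)$ is zero, and hence the space $\bigoplus_q H^q(X,\mathcal Ext^k(\mathcal E,\mathcal G))$ of vertex operators for strings of ghost number $k$ from $\mathcal E$ to $\mathcal G$ is zero. (2) For every $k\ge 0$ there is an isomorphism of complex vector spaces $$\mathit{Ext}^k(\mathcal E,\mathcal G)\;\cong\; H^k\big(X,\mathcal Hom(\mathcal E,\mathcal G)\big),$$ natural in the locally free $\mathcal O$-module $\mathcal E$ of finite rank and in the coherent $\mathcal O$-module $\mathcal G$. -/

import Mathlib

open CategoryTheory Limits Opposite TopologicalSpace
open scoped Manifold ContDiff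

universe u

/-! ## Presheaves of algebras over a base ring -/

/-- A presheaf of rings `R` with the structure of a presheaf of `K`-algebras: every ring of
sections is a `K`-algebra and the restriction maps are `K`-linear. -/
class PresheafAlgebra {C : Type u} [SmallCategory C] (K : Type u) [CommRing K]
    (R : Cᵒᵖ ⥤ RingCat.{u}) where
  algebra : ∀ U : Cᵒᵖ, Algebra K (R.obj U)
  map_algebraMap : ∀ {U V : Cᵒᵖ} (f : U ⟶ V) (c : K),
    R.map f (algebraMap K (R.obj U) c) = algebraMap K (R.obj V) c

attribute [reducible, instance] PresheafAlgebra.algebra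

section Linear

variable {C : Type u} [SmallCategory C] {J : GrothendieckTopology C} (K : Type u) [CommRing K]

/-- The restriction of a sheaf of `K`-algebras to an object of the site. -/
instance PresheafAlgebra.over (R : Sheaf J RingCat.{u}) [PresheafAlgebra K R.obj] (U : C) :
    PresheafAlgebra K (R.over U).obj where
  algebra V := PresheafAlgebra.algebra (K := K) (R := R.obj) (op V.unop.left)
  map_algebraMap f c := PresheafAlgebra.map_algebraMap (K := K) (R := R.obj) f.unop.left.op c

namespace PresheafOfModules

variable {K} {R : Cᵒᵖ ⥤ RingCat.{u}} [PresheafAlgebra K R]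

/-- The scalar multiple `c • f` of a morphism `f` of presheaves of modules:
`(c • f) m = c • f m` on sections. -/
noncomputable def smulHom {M N : PresheafOfModules.{u} R} (c : K) (f : M ⟶ N) : M ⟶ N where
  app U := ModuleCat.ofHom
    { toFun := fun m => algebraMap K (R.obj U) c • f.app U m
      map_add' := fun x y => by rw [map_add, smul_add]
      map_smul' := fun r x => by
        rw [map_smul, RingHom.id_apply, smul_smul, smul_smul, Algebra.commutes] }
  naturality {U V} g := by
    ext x
    change algebraMap K (R.obj V) c • f.app V (M.map g x)
      = N.map g (algebraMap K (R.obj U) c • f.app U x)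
    rw [PresheafOfModules.map_smul, PresheafAlgebra.map_algebraMap, naturality_apply]
    rfl

lemma smulHom_app_apply {M N : PresheafOfModules.{u} R} (c : K) (f : M ⟶ N) (U : Cᵒᵖ)
    (m : M.obj U) : (smulHom c f).app U m = algebraMap K (R.obj U) c • f.app U m := rfl

end PresheafOfModules

namespace SheafOfModules

variable {R : Sheaf J RingCat.{u}} [PresheafAlgebra K R.obj]

noncomputable instance homModule (M N : SheafOfModules.{u} R) : Module K (M ⟶ N) where
  smul c f := ⟨PresheafOfModules.smulHom c f.val⟩
  one_smul f := by
    ext U m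
    change algebraMap K (R.obj.obj U) 1 • f.val.app U m = _
    rw [map_one, one_smul]
  mul_smul c d f := by
    ext U m
    change algebraMap K (R.obj.obj U) (c * d) • f.val.app U m =
      algebraMap K (R.obj.obj U) c • algebraMap K (R.obj.obj U) d • f.val.app U m
    rw [map_mul, mul_smul]
  smul_zero c := by
    ext U m
    change algebraMap K (R.obj.obj U) c • (0 : N.val.obj U) = 0
    rw [smul_zero]
  smul_add c f g := by
    ext U m
    change algebraMap K (R.obj.obj U) c • (f.val.app U m + g.val.app U m) = _
    rw [smul_add]
    rfl
  add_smul c d f := by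
    ext U m
    change algebraMap K (R.obj.obj U) (c + d) • f.val.app U m = _
    rw [map_add, add_smul]
    rfl
  zero_smul f := by
    ext U m
    change algebraMap K (R.obj.obj U) 0 • f.val.app U m = 0
    rw [map_zero, zero_smul]

lemma smul_val_app_apply {M N : SheafOfModules.{u} R} (c : K) (f : M ⟶ N) (U : Cᵒᵖ)
    (m : M.val.obj U) :
    (c • f).val.app U m = algebraMap K (R.obj.obj U) c • f.val.app U m := rfl

/-- Sheaves of modules over a sheaf of `K`-algebras form a `K`-linear category. -/
noncomputable instance linear : Linear K (SheafOfModules.{u} R) where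
  homModule := homModule K
  smul_comp M N P c f g := by
    ext U m
    change g.val.app U (algebraMap K (R.obj.obj U) c • f.val.app U m) = _
    rw [map_smul]
    rfl
  comp_smul M N P f c g := by
    ext U m
    rfl

end SheafOfModules

end Linear

/-! ## The category of sheaves of modules has enough injectives -/

namespace SheafOfModules

section Grothendieck

variable {C : Type u} [SmallCategory C] {J : GrothendieckTopology C} (R : Sheaf J RingCat.{u})

instance hasExactColimitsOfShape (I : Type u) [SmallCategory I] [IsFiltered I] :
    HasExactColimitsOfShape I (SheafOfModules.{u} R) :=
  have : HasExactColimitsOfShape I (PresheafOfModules.{u} R.obj) :=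
    HasExactColimitsOfShape.domain_of_functor I (PresheafOfModules.toPresheaf R.obj)
  (PresheafOfModules.sheafificationAdjunction (𝟙 R.obj)).hasExactColimitsOfShape I

instance hasSeparator : HasSeparator (SheafOfModules.{u} R) where
  hasSeparator := by
    let a := PresheafOfModules.sheafificationAdjunction (𝟙 R.obj)
    let G : C → SheafOfModules.{u} R := fun X =>
      (PresheafOfModules.sheafification (𝟙 R.obj)).obj
        ((yoneda ⋙ PresheafOfModules.free R.obj).obj X)
    have hG : ObjectProperty.IsSeparating (.ofObj G) := by
      intro M N f g hfg
      apply (SheafOfModules.forget R ⋙ PresheafOfModules.restrictScalars (𝟙 R.obj)).map_injective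
      refine PresheafOfModules.freeYoneda.isSeparating R.obj _ _ ?_
      rintro _ ⟨X⟩ p
      apply (a.homEquiv _ _).symm.injective
      simpa only [← Adjunction.homEquiv_naturality_right_symm] using
        hfg _ (ObjectProperty.ofObj_apply _ X) ((a.homEquiv _ _).symm p)
    exact ⟨_, hG.isSeparator_coproduct⟩

instance isGrothendieckAbelian : IsGrothendieckAbelian.{u} (SheafOfModules.{u} R) where
  ab5OfSize := { ofShape := fun _ _ _ => inferInstance }

end Grothendieck

/-! ## The sheaf of homomorphisms -/

section HomSheaf

variable {C : Type u} [SmallCategory C] {J : GrothendieckTopology C} {R : Sheaf J RingCat.{u}}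

/-- The restriction of a morphism `φ : E|_V ⟶ G|_V` along `f : U ⟶ V`. -/
noncomputable def restrictHom {E G : SheafOfModules.{u} R} {U V : C} (f : U ⟶ V)
    (φ : E.over V ⟶ G.over V) : E.over U ⟶ G.over U :=
  (overFunctorMap R f).inv.app E ≫ (overMap R f).map φ ≫ (overFunctorMap R f).hom.app G

lemma restrictHom_app {E G : SheafOfModules.{u} R} {U V : C} (f : U ⟶ V)
    (φ : E.over V ⟶ G.over V) (W : Over U) (s : E.val.obj (op W.left)) :
    (restrictHom f φ).val.app (op W) s = φ.val.app (op ((Over.map f).obj W)) s := rfl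

variable (K : Type u) [CommRing K] [PresheafAlgebra K R.obj]

/-- The presheaf `U ↦ Hom(E|_U, G|_U)` of `K`-modules. -/
noncomputable def homPresheaf (E G : SheafOfModules.{u} R) : Cᵒᵖ ⥤ ModuleCat.{u} K where
  obj U := ModuleCat.of K (E.over U.unop ⟶ G.over U.unop)
  map f := ModuleCat.ofHom
    { toFun := restrictHom f.unop
      map_add' := fun _ _ => rfl
      map_smul' := fun _ _ => rfl }
  map_id U := by
    ext φ : 2
    refine SheafOfModules.hom_ext (PresheafOfModules.hom_ext fun W => ?_)
    ext s
    exact ConcreteCategory.congr_hom (NatTrans.congr_app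
      (ConcreteCategory.congr_hom ((presheafHom E.val.presheaf G.val.presheaf).map_id U)
        ((PresheafOfModules.toPresheaf _).map φ.val)) W) s
  map_comp {U V W} f g := by
    ext φ : 2
    refine SheafOfModules.hom_ext (PresheafOfModules.hom_ext fun T => ?_)
    ext s
    exact ConcreteCategory.congr_hom (NatTrans.congr_app
      (ConcreteCategory.congr_hom ((presheafHom E.val.presheaf G.val.presheaf).map_comp f g)
        ((PresheafOfModules.toPresheaf _).map φ.val)) T) s

/-- The underlying morphisms of abelian presheaves of local homomorphisms of modules. -/
noncomputable def homPresheafι (E G : SheafOfModules.{u} R) :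
    homPresheaf K E G ⋙ CategoryTheory.forget (ModuleCat.{u} K) ⟶
      presheafHom E.val.presheaf G.val.presheaf where
  app _ := ↾fun φ => (PresheafOfModules.toPresheaf _).map (Hom.val φ)
  naturality _ _ _ := rfl

lemma homPresheaf_isSheaf (E G : SheafOfModules.{u} R) :
    Presheaf.IsSheaf J (homPresheaf K E G) := by
  rw [Presheaf.isSheaf_iff_isSheaf_forget J _ (CategoryTheory.forget (ModuleCat.{u} K)),
    isSheaf_iff_isSheaf_of_type]
  have hH := (isSheaf_iff_isSheaf_of_type J _).1 (Presheaf.IsSheaf.hom E.val.presheaf _ G.isSheaf)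
  have hinj : ∀ U, Function.Injective ((homPresheafι K E G).app U) := by
    intro U φ ψ h
    refine SheafOfModules.hom_ext ((PresheafOfModules.toPresheaf _).map_injective h)
  intro U S hS x hx
  obtain ⟨y, hy, -⟩ := hH S hS (x.map (homPresheafι K E G)) (hx.map _)
  have key : ∀ (W : Over U) (Z : C) (p : Z ⟶ W.left) (hp : S (p ≫ W.hom))
      (m : E.val.obj (op W.left)),
      G.val.map p.op (y.app (op W) m : G.val.obj (op W.left)) =
        (Hom.val (x (p ≫ W.hom) hp)).app (op (Over.mk (𝟙 Z))) (E.val.map p.op m) := by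
    intro W Z p hp m
    have h1 := (PresheafHom.isAmalgamation_iff S _ (hx.map _) y).1 hy Z (p ≫ W.hom) hp
    have h2 := ConcreteCategory.congr_hom
      (y.naturality (Over.homMk p : Over.mk (p ≫ W.hom) ⟶ W).op) m
    refine Eq.trans h2.symm ?_
    exact ConcreteCategory.congr_hom h1 (E.val.map p.op m)
  have hlin : ∀ (W : (Over U)ᵒᵖ) (r : R.obj.obj (op W.unop.left))
      (m : E.val.obj (op W.unop.left)),
      @Eq (G.val.obj (op W.unop.left)) (y.app W (r • m : E.val.obj (op W.unop.left)))
        (HSMul.hSMul (β := G.val.obj (op W.unop.left)) r (y.app W m)) := by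
    intro W r m
    have hsep := (((Presheaf.isSheaf_iff_isSheaf_forget J _
      (CategoryTheory.forget AddCommGrpCat.{u})).1 G.isSheaf).isSheafFor _ 
        (J.pullback_stable W.unop.hom hS)).isSeparatedFor
    refine hsep.ext fun Z p hp => ?_
    change G.val.map p.op _ = G.val.map p.op _
    refine (key W.unop Z p hp _).trans ?_
    rw [PresheafOfModules.map_smul]
    refine (LinearMap.map_smul ((Hom.val (x (p ≫ W.unop.hom) hp)).app (op (Over.mk (𝟙 Z)))).hom
      (show (R.over Z).obj.obj (op (Over.mk (𝟙 Z))) from R.obj.map p.op r)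
      (show (E.over Z).val.obj (op (Over.mk (𝟙 Z))) from E.val.map p.op m)).trans ?_
    refine Eq.trans ?_ (PresheafOfModules.map_smul G.val p.op r _).symm
    exact congrArg (HSMul.hSMul (β := G.val.obj (op Z)) (R.obj.map p.op r))
      (key W.unop Z p hp m).symm
  let t : E.over U ⟶ G.over U :=
    ⟨PresheafOfModules.homMk (M₁ := (E.over U).val) (M₂ := (G.over U).val) y hlin⟩
  have ht : (homPresheafι K E G).app (op U) t = y := rfl
  refine ⟨t, fun V f hf => hinj _ (hy f hf), fun t' ht' => hinj _ ?_⟩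
  refine (hH S hS).isSeparatedFor.ext fun V f hf => ?_
  exact (congr_arg ((homPresheafι K E G).app (op V)) (ht' f hf)).trans (hy f hf).symm

/-- The sheaf `𝓗om(E, G)`: its sections over `U` are the homomorphisms of `R|_U`-modules
from `E|_U` to `G|_U`. It is regarded as a sheaf of `K`-modules. -/
noncomputable def homSheaf (E G : SheafOfModules.{u} R) : Sheaf J (ModuleCat.{u} K) :=
  ⟨homPresheaf K E G, homPresheaf_isSheaf K E G⟩

/-- The functoriality of `𝓗om(E, G)` in both variables: on sections, `φ ↦ f ∘ φ ∘ g`. -/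
noncomputable def homSheafMap {E E' G G' : SheafOfModules.{u} R} (g : E' ⟶ E) (f : G ⟶ G') :
    homSheaf K E G ⟶ homSheaf K E' G' where
  hom :=
    { app := fun U => ModuleCat.ofHom
        { toFun := fun (φ : E.over U.unop ⟶ G.over U.unop) =>
            Hom.over g U.unop ≫ φ ≫ Hom.over f U.unop
          map_add' := fun φ ψ => by
            rw [Preadditive.add_comp, Preadditive.comp_add]
          map_smul' := fun c φ => by
            rw [Linear.smul_comp, Linear.comp_smul]
            rfl }
      naturality := fun _ _ _ => rfl }

/-- The functor `𝓗om(E, ·)` from sheaves of modules to sheaves of `K`-modules. -/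
noncomputable def homSheafFunctor (E : SheafOfModules.{u} R) :
    SheafOfModules.{u} R ⥤ Sheaf J (ModuleCat.{u} K) where
  obj G := homSheaf K E G
  map f := homSheafMap K (𝟙 E) f
  map_id _ := rfl
  map_comp _ _ := rfl

instance (E : SheafOfModules.{u} R) : (homSheafFunctor K E).Additive where
  map_add := rfl

/-- The sheaf `𝓔xt^k(E, G)`: the `k`-th right derived functor of `𝓗om(E, ·)` applied to `G`. -/
noncomputable def extSheaf (k : ℕ) (E G : SheafOfModules.{u} R) : Sheaf J (ModuleCat.{u} K) :=
  ((homSheafFunctor K E).rightDerived k).obj G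

end HomSheaf

/-! ## Locally free and coherent sheaves of modules -/

section Coherent

variable {C : Type u} [SmallCategory C] {J : GrothendieckTopology C} {R : Sheaf J RingCat.{u}}

/-- `M` is locally free of finite rank: there is a cover such that on each member `U` of it there
is an isomorphism `R|_U ^ I ≅ M|_U` with `I` a finite set (which may depend on `U`). -/
def IsLocallyFreeOfFiniteRank (M : SheafOfModules.{u} R) : Prop :=
  ∃ q : LocalGeneratorsData.{u} M, q.IsLocallyFreeData ∧ q.IsFiniteType

/-- `M` is coherent: it is of finite type, and for every `U` and every homomorphism
`φ : R|_U ^ I ⟶ M|_U` with `I` finite, the kernel of `φ` is of finite type. -/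
def IsCoherent (M : SheafOfModules.{u} R) : Prop :=
  M.IsFiniteType ∧ ∀ (U : C) (I : Type u) [Finite I] (φ : free I ⟶ M.over U),
    (kernel φ).IsFiniteType

end Coherent

end SheafOfModules

/-! ## Sheaf cohomology -/

section Cohomology

variable {C : Type u} [SmallCategory C] {J : GrothendieckTopology C} {K : Type u} [CommRing K]

/-- The sheaf cohomology `H^q(F)` of a sheaf `F` of `K`-modules, defined
as the `K`-module `Ext^q` from the constant sheaf `K` to `F` in the category of sheaves of
`K`-modules. -/
noncomputable abbrev sheafCohomology (F : Sheaf J (ModuleCat.{u} K)) (q : ℕ) : Type u :=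
  Abelian.Ext ((constantSheaf J (ModuleCat.{u} K)).obj (ModuleCat.of K K)) F q

variable (K) in
/-- The space `⨁_q H^q(𝓔xt^k(E, G))` of vertex operators for strings of ghost number `k` from
`E` to `G`. -/
abbrev vertexOperators {R : Sheaf J RingCat.{u}} [PresheafAlgebra K R.obj] (k : ℕ)
    (E G : SheafOfModules.{u} R) : Type u :=
  DirectSum ℕ fun q => sheafCohomology (SheafOfModules.extSheaf K k E G) q

end Cohomology

/-! ## Complex manifolds -/

section ComplexManifold

variable (n : ℕ) (X : Type) [TopologicalSpace X] [ChartedSpace (EuclideanSpace ℂ (Fin n)) X]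

/-- The sheaf `𝒪` of holomorphic functions on a complex manifold `X` of dimension `n`: its sections
over `U` are the functions `U → ℂ` that are smooth over `ℂ` in the charts, i.e. holomorphic. -/
noncomputable def holomorphicSheaf :
    Sheaf (Opens.grothendieckTopology (TopCat.of X)) RingCat.{0} :=
  smoothSheafRing 𝓘(ℂ, EuclideanSpace ℂ (Fin n)) 𝓘(ℂ) X ℂ

noncomputable instance : PresheafAlgebra ℂ (holomorphicSheaf n X).obj where
  algebra U := inferInstanceAs (Algebra ℂ
    C^∞⟮𝓘(ℂ, EuclideanSpace ℂ (Fin n)), (unop U : Opens X); 𝓘(ℂ), ℂ⟯)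
  map_algebraMap _ _ := rfl

end ComplexManifold

/-! Write F for the functor `homSheafFunctor K E`, that is 𝓗om(E, ·). When E is locally free of
finite rank, F is exact: it is a right adjoint, hence left exact, and over a trivializing open set a
homomorphism out of E is a finite family of sections, so it lifts locally along an epimorphism
(`preservesEpimorphisms_homSheafFunctor`). The higher derived functors of an exact functor vanish,
which gives (1).

For (2) no spectral sequence is needed. The left adjoint of F is S ↦ E ⊗_K S
(`tensorHomAdjunction`). It preserves monomorphisms, because K is a field and sheafification is left
exact, so F preserves injectives. The identity of E is a global section of 𝓗om(E, E), that is, a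
morphism e from the constant sheaf K to F(E), and f ↦ e ≫ F(f) is the bijection between Hom(E, G)
and the global sections of 𝓗om(E, G) (`homSheafUnit_comp_bijective`). Since F is exact and preserves
injectives, dimension shifting carries this bijection from degree 0 to every degree
(`mk₀_comp_mapExactFunctor_bijective`).

The isomorphism is thus x ↦ e · F(x). Naturality in G is functoriality of F. Naturality in E holds
because g : E' ⟶ E induces a natural transformation between the two Hom functors, and exact functors
act on Ext compatibly with natural transformations (`mapExactFunctor_naturality`). -/

open scoped TensorProduct

/-! ### Homological algebra: exact functors, derived functors and Ext. -/

namespace CategoryTheory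

open Abelian

universe w w' v v' u₁ u₂

variable {A : Type u₁} [Category.{v} A] [Abelian A] {B : Type u₂} [Category.{v'} B] [Abelian B]

/-- A left exact functor between abelian categories that preserves epimorphisms is right exact. -/
lemma Functor.preservesFiniteColimits_of_preservesEpimorphisms (F : A ⥤ B) [F.Additive]
    [PreservesFiniteLimits F] [F.PreservesEpimorphisms] : PreservesFiniteColimits F := by
  have hF : ∀ S : ShortComplex A, S.ShortExact → (S.map F).Exact ∧ Mono (F.map S.f) :=
    (F.preservesFiniteLimits_tfae.out 3 0).1 ‹_›
  suffices PreservesFiniteLimits F ∧ PreservesFiniteColimits F from this.2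
  refine (F.exact_tfae.out 0 3).1 fun S hS => ?_
  have := hS.mono_f
  have := hS.epi_g
  exact
    { exact := (hF S hS).1
      mono_f := inferInstanceAs (Mono (F.map S.f))
      epi_g := inferInstanceAs (Epi (F.map S.g)) }

/-- The higher right derived functors of an exact functor are zero. -/
lemma Functor.isZero_rightDerived_obj_of_exact [HasInjectiveResolutions A] (F : A ⥤ B) [F.Additive]
    [PreservesFiniteLimits F] [PreservesFiniteColimits F] (X : A) {k : ℕ} (hk : 0 < k) :
    IsZero ((F.rightDerived k).obj X) := by
  let I := injectiveResolution X
  refine IsZero.of_iso ?_ (I.isoRightDerivedObj F k)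
  -- Positivity of `k` enters here: an injective resolution is exact only in positive degrees.
  have hI : I.cocomplex.ExactAt k := by
    obtain ⟨m, rfl⟩ := Nat.exists_eq_succ_of_ne_zero hk.ne'
    exact I.cocomplex_exactAt_succ m
  have h : ((F.mapHomologicalComplex _).obj I.cocomplex).ExactAt k := ShortComplex.Exact.map hI F
  exact h.isZero_homology

namespace Abelian.Ext

variable [HasExt.{w} A] [HasExt.{w'} B]

/-- Compatibility with connecting maps, the engine of the dimension shifts below. The objects are
spelled out because `F.obj S.X₃` and `(S.map F).X₃` agree only by unfolding. -/
lemma mapExactFunctor_comp_extClass (F : A ⥤ B) [F.Additive] [PreservesFiniteLimits F]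
    [PreservesFiniteColimits F] {S : ShortComplex A} (hS : S.ShortExact) {X : A} {k : ℕ}
    (y : Ext X S.X₃ k) :
    (y.comp hS.extClass rfl).mapExactFunctor F =
      Ext.comp (Y := (S.map F).X₃) (Z := (S.map F).X₁) (y.mapExactFunctor F)
        (hS.map_of_exact F).extClass rfl := by
  rw [mapExactFunctor_comp, mapExactFunctor_extClass]
  rfl

/-- Naturality of the action of exact functors on `Ext` with respect to natural
transformations. -/
lemma mapExactFunctor_naturality [EnoughInjectives A] {F F' : A ⥤ B} [F.Additive] [F'.Additive]
    [PreservesFiniteLimits F] [PreservesFiniteColimits F]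
    [PreservesFiniteLimits F'] [PreservesFiniteColimits F'] (τ : F ⟶ F') {X Y : A} {k : ℕ}
    (x : Ext X Y k) :
    (x.mapExactFunctor F).comp (mk₀ (τ.app Y)) (add_zero k) =
      (mk₀ (τ.app X)).comp (x.mapExactFunctor F') (zero_add k) := by
  induction k generalizing Y with
  | zero =>
    obtain ⟨f, rfl⟩ := (mk₀_bijective X Y).2 x
    simp [mapExactFunctor_mk₀]
  | succ k hk =>
    -- Dimension shift: embed `Y` in an injective object. Positive Ext into it vanishes, so `x` is
    -- the connecting image of a class `y` one degree lower, and the claim reduces to `y` and to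
    -- naturality of extension classes.
    let S := ShortComplex.mk _ _ (cokernel.condition (Injective.ι Y))
    have hS : S.ShortExact := { exact := ShortComplex.exact_cokernel (Injective.ι Y) }
    obtain ⟨y, rfl⟩ := covariant_sequence_exact₁ X hS x (eq_zero_of_injective _) rfl
    have h := ShortComplex.ShortExact.extClass_naturality (hS.map_of_exact F) (hS.map_of_exact F')
      (S.mapNatTrans τ)
    rw [mapExactFunctor_comp_extClass, mapExactFunctor_comp_extClass]
    refine (comp_assoc (X := F.obj X) (Y := (S.map F).X₃) (Z := (S.map F).X₁)
      (T := (S.map F').X₁) (y.mapExactFunctor F) (hS.map_of_exact F).extClass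
      (mk₀ (S.mapNatTrans τ).τ₁) rfl (add_zero 1) rfl).trans ?_
    refine (congrArg (fun z => Ext.comp (Y := (S.map F).X₃) (y.mapExactFunctor F) z rfl) h).trans ?_
    refine (comp_assoc (X := F.obj X) (Y := (S.map F).X₃) (Z := (S.map F').X₃)
      (T := (S.map F').X₁) (y.mapExactFunctor F) (mk₀ (S.mapNatTrans τ).τ₃)
      (hS.map_of_exact F').extClass (add_zero k) (zero_add 1) (by rw [add_zero])).symm.trans ?_
    refine (congrArg (fun z => Ext.comp (Y := (S.map F').X₃) z (hS.map_of_exact F').extClass rfl)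
      (hk y)).trans ?_
    exact comp_assoc (X := F.obj X) (Y := F'.obj X) (Z := (S.map F').X₃)
      (T := (S.map F').X₁) _ _ _ (zero_add k) rfl (by rw [zero_add])

variable (F : A ⥤ B) [F.Additive] [PreservesFiniteLimits F] [PreservesFiniteColimits F]

/-- Let `F` be an exact functor which preserves injective objects and let `e : Z ⟶ F.obj X`. If `e`
induces bijections `Hom(X, Y) → Hom(Z, F Y)`, then it induces bijections
`Ext^k(X, Y) → Ext^k(Z, F Y)`. -/
lemma mk₀_comp_mapExactFunctor_bijective [EnoughInjectives A] [F.PreservesInjectiveObjects]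
    {X : A} {Z : B} (e : Z ⟶ F.obj X)
    (he : ∀ Y : A, Function.Bijective fun f : X ⟶ Y => e ≫ F.map f) (Y : A) (k : ℕ) :
    Function.Bijective fun x : Ext X Y k =>
      (mk₀ e).comp (x.mapExactFunctor F) (zero_add k) := by
  induction k generalizing Y with
  | zero =>
    have h : (fun x : Ext X Y 0 => (mk₀ e).comp (x.mapExactFunctor F) (zero_add 0)) ∘ mk₀ =
        mk₀ ∘ fun f : X ⟶ Y => e ≫ F.map f := by
      ext1 f
      simp [mapExactFunctor_mk₀]
    rw [← Function.Bijective.of_comp_iff _ (mk₀_bijective X Y), h]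
    exact (mk₀_bijective _ _).comp (he Y)
  | succ k hk =>
    let S := ShortComplex.mk _ _ (cokernel.condition (Injective.ι Y))
    have hS : S.ShortExact := { exact := ShortComplex.exact_cokernel (Injective.ι Y) }
    -- Preservation of injectives makes the same shift available after applying `F`.
    have hI : Injective (S.map F).X₂ := inferInstanceAs (Injective (F.obj (Injective.under Y)))
    constructor
    · refine (injective_iff_map_eq_zero
        (((mk₀ e).precomp _ (zero_add (k + 1))).comp (F.mapExtAddHom X Y (k + 1)))).2 fun x hx => ?_
      change (mk₀ e).comp (x.mapExactFunctor F) (zero_add (k + 1)) = 0 at hx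
      obtain ⟨y, rfl⟩ := covariant_sequence_exact₁ X hS x (eq_zero_of_injective _) rfl
      rw [mapExactFunctor_comp_extClass] at hx
      replace hx := (comp_assoc (X := Z) (Y := F.obj X) (Z := (S.map F).X₃) (T := (S.map F).X₁)
        (mk₀ e) (y.mapExactFunctor F) (hS.map_of_exact F).extClass (zero_add k) rfl
        (by rw [zero_add])).trans hx
      -- The image of `y` has zero connecting image, so it comes from a class `z` with values in `F`
      -- of the injective object. Surjectivity in degree `k` lifts `z` to `t`, and injectivity in
      -- degree `k` shows that `t` maps to `y`; hence the connecting image of `y` is zero.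
      obtain ⟨z, hz⟩ := covariant_sequence_exact₃ Z (hS.map_of_exact F) _ rfl hx
      obtain ⟨t, rfl⟩ := (hk _).2 z
      have : t.comp (mk₀ S.g) (add_zero k) = y := by
        apply (hk _).1
        refine Eq.trans ?_ hz
        dsimp only
        rw [mapExactFunctor_comp, mapExactFunctor_mk₀]
        exact (comp_assoc (mk₀ e) (t.mapExactFunctor F) (mk₀ (F.map S.g)) (zero_add k)
          (add_zero k) (by rw [zero_add, add_zero])).symm
      rw [← this, comp_assoc _ _ _ (add_zero k) (zero_add 1) (by rw [add_zero]),
        hS.comp_extClass, comp_zero]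
    · intro y
      obtain ⟨z, rfl⟩ := covariant_sequence_exact₁ Z (hS.map_of_exact F) y
        (eq_zero_of_injective _) rfl
      obtain ⟨x, rfl⟩ := (hk _).2 z
      refine ⟨x.comp hS.extClass rfl, ?_⟩
      dsimp only
      rw [mapExactFunctor_comp_extClass]
      exact (comp_assoc (X := Z) (Y := F.obj X) (Z := (S.map F).X₃) (T := (S.map F).X₁)
        (mk₀ e) (x.mapExactFunctor F) (hS.map_of_exact F).extClass (zero_add k) rfl
        (by rw [zero_add])).symm

variable (k : Type*) [CommRing k] [Linear k A] [Linear k B]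

/-- The isomorphism `Ext^i(X, Y) ≃ Ext^i(Z, F Y)` given by a linear exact functor `F` which preserves
injective objects and a morphism `e : Z ⟶ F.obj X` such that `Hom(X, Y) → Hom(Z, F Y)` is
bijective for all `Y`. -/
noncomputable def linearEquivMapExactFunctor [F.Linear k] [EnoughInjectives A]
    [F.PreservesInjectiveObjects] {X : A} {Z : B} (e : Z ⟶ F.obj X)
    (he : ∀ Y : A, Function.Bijective fun f : X ⟶ Y => e ≫ F.map f) (Y : A) (i : ℕ) :
    Ext X Y i ≃ₗ[k] Ext Z (F.obj Y) i :=
  LinearEquiv.ofBijective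
    (bilinearCompOfLinear k Z (F.obj X) (F.obj Y) 0 i i (zero_add i) (mk₀ e) ∘ₗ
      F.mapExtLinearMap k X Y i)
    (mk₀_comp_mapExactFunctor_bijective F e he Y i)

lemma linearEquivMapExactFunctor_apply [F.Linear k] [EnoughInjectives A]
    [F.PreservesInjectiveObjects] {X : A} {Z : B} (e : Z ⟶ F.obj X)
    (he : ∀ Y : A, Function.Bijective fun f : X ⟶ Y => e ≫ F.map f) {Y : A} {i : ℕ}
    (x : Ext X Y i) :
    linearEquivMapExactFunctor F k e he Y i x =
      (mk₀ e).comp (x.mapExactFunctor F) (zero_add i) := rfl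

/-- Associativity moves `τ` past the image of `x` by `mapExactFunctor_naturality`; then `hg` trades
`τ` at `X` for `F'.map g`. -/
lemma linearEquivMapExactFunctor_naturality [EnoughInjectives A] {F F' : A ⥤ B} [F.Additive]
    [F'.Additive] [PreservesFiniteLimits F] [PreservesFiniteColimits F] [PreservesFiniteLimits F']
    [PreservesFiniteColimits F'] [F.Linear k] [F'.Linear k] [F.PreservesInjectiveObjects]
    [F'.PreservesInjectiveObjects] (τ : F ⟶ F') {X X' : A} {Z : B}
    (e : Z ⟶ F.obj X) (he : ∀ Y : A, Function.Bijective fun f : X ⟶ Y => e ≫ F.map f)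
    (e' : Z ⟶ F'.obj X') (he' : ∀ Y : A, Function.Bijective fun f : X' ⟶ Y => e' ≫ F'.map f)
    (g : X' ⟶ X) (hg : e ≫ τ.app X = e' ≫ F'.map g) {Y Y' : A} (f : Y ⟶ Y') {i : ℕ}
    (x : Ext X Y i) :
    linearEquivMapExactFunctor F' k e' he' Y' i
        (((mk₀ g).comp x (zero_add i)).comp (mk₀ f) (add_zero i)) =
      (linearEquivMapExactFunctor F k e he Y i x).comp (mk₀ (τ.app Y ≫ F'.map f))
        (add_zero i) := by
  rw [linearEquivMapExactFunctor_apply, linearEquivMapExactFunctor_apply, mapExactFunctor_comp,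
    mapExactFunctor_comp, mapExactFunctor_mk₀, mapExactFunctor_mk₀, ← mk₀_comp_mk₀,
    ← comp_assoc _ (mk₀ (τ.app Y)) _ (add_zero i) (zero_add 0) (by rw [add_zero, add_zero]),
    comp_assoc (mk₀ e) _ _ (zero_add i) (add_zero i) (by rw [zero_add, add_zero]),
    mapExactFunctor_naturality,
    ← comp_assoc (mk₀ e) _ _ (zero_add 0) (zero_add i) (by rw [zero_add, zero_add]),
    mk₀_comp_mk₀, hg, ← mk₀_comp_mk₀,
    comp_assoc (mk₀ e') _ _ (zero_add 0) (zero_add i) (by rw [zero_add, zero_add]),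
    comp_assoc (mk₀ e') _ _ (zero_add i) (add_zero i) (by rw [zero_add, add_zero])]

end Abelian.Ext

end CategoryTheory

/-! ### The presheaf tensor product E ⊗_K S and its adjunction with 𝓗om(E, ·). -/

namespace SheafOfModules

variable {C : Type u} [SmallCategory C] {J : GrothendieckTopology C} {R : Sheaf J RingCat.{u}}
  (K : Type u) [CommRing K] [PresheafAlgebra K R.obj]

section

variable (E : SheafOfModules.{u} R) (U : Cᵒᵖ)

/-- The `K`-module of sections over `U` of a sheaf of modules over a sheaf of `K`-algebras. -/
noncomputable abbrev sectionsModule : Module K (E.val.obj U) :=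
  Module.compHom _ (algebraMap K (R.obj.obj U))

attribute [local instance] sectionsModule

lemma smul_sections_def (c : K) (e : E.val.obj U) : c • e = algebraMap K (R.obj.obj U) c • e := rfl

instance : IsScalarTower K (R.obj.obj U) (E.val.obj U) where
  smul_assoc c r e := by
    rw [smul_sections_def, smul_smul, Algebra.smul_def]

instance : SMulCommClass (R.obj.obj U) K (E.val.obj U) where
  smul_comm r c e := by
    rw [smul_sections_def, smul_sections_def, smul_smul, smul_smul, Algebra.commutes]

end

attribute [local instance] sectionsModule

/-- The restriction maps of a sheaf of modules are `K`-linear. -/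
noncomputable def sectionsRestrict (E : SheafOfModules.{u} R) {U V : Cᵒᵖ} (f : U ⟶ V) :
    E.val.obj U →ₗ[K] E.val.obj V where
  toFun e := E.val.map f e
  map_add' := map_add (E.val.map f).hom
  map_smul' c e := by
    rw [smul_sections_def, PresheafOfModules.map_smul, PresheafAlgebra.map_algebraMap]
    rfl

lemma sectionsRestrict_smul (E : SheafOfModules.{u} R) {U V : Cᵒᵖ} (f : U ⟶ V)
    (r : R.obj.obj U) (e : E.val.obj U) :
    sectionsRestrict K E f (r • e) = R.obj.map f r • sectionsRestrict K E f e :=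
  PresheafOfModules.map_smul _ _ _ _

lemma sectionsRestrict_id (E : SheafOfModules.{u} R) (U : Cᵒᵖ) (e : E.val.obj U) :
    sectionsRestrict K E (𝟙 U) e = e :=
  ConcreteCategory.congr_hom (E.val.presheaf.map_id U) e

lemma sectionsRestrict_comp (E : SheafOfModules.{u} R) {U V W : Cᵒᵖ} (f : U ⟶ V) (g : V ⟶ W)
    (e : E.val.obj U) :
    sectionsRestrict K E (f ≫ g) e = sectionsRestrict K E g (sectionsRestrict K E f e) :=
  ConcreteCategory.congr_hom (E.val.presheaf.map_comp f g) e

section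

variable (E : SheafOfModules.{u} R) (S S' : Cᵒᵖ ⥤ ModuleCat.{u} K)

/-- The restriction maps of the presheaf `U ↦ E(U) ⊗_K S(U)`. -/
noncomputable def tensorRestrict {U V : Cᵒᵖ} (f : U ⟶ V) :
    E.val.obj U ⊗[K] S.obj U →ₗ[K] E.val.obj V ⊗[K] S.obj V :=
  TensorProduct.map (sectionsRestrict K E f) (S.map f).hom

@[simp]
lemma tensorRestrict_tmul {U V : Cᵒᵖ} (f : U ⟶ V) (e : E.val.obj U) (x : S.obj U) :
    tensorRestrict K E S f (e ⊗ₜ x) = sectionsRestrict K E f e ⊗ₜ S.map f x := rfl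

lemma tensorRestrict_smul {U V : Cᵒᵖ} (f : U ⟶ V) (r : R.obj.obj U)
    (t : E.val.obj U ⊗[K] S.obj U) :
    tensorRestrict K E S f (r • t) = R.obj.map f r • tensorRestrict K E S f t := by
  induction t with
  | zero => simp
  | add x y hx hy => rw [smul_add, map_add, hx, hy, map_add, smul_add]
  | tmul e x =>
    rw [TensorProduct.smul_tmul', tensorRestrict_tmul, tensorRestrict_tmul,
      sectionsRestrict_smul, TensorProduct.smul_tmul']

lemma tensorRestrict_id (U : Cᵒᵖ) : tensorRestrict K E S (𝟙 U) = LinearMap.id :=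
  TensorProduct.ext' fun e x => by simp [sectionsRestrict_id]

lemma tensorRestrict_comp {U V W : Cᵒᵖ} (f : U ⟶ V) (g : V ⟶ W) :
    tensorRestrict K E S (f ≫ g) = tensorRestrict K E S g ∘ₗ tensorRestrict K E S f :=
  TensorProduct.ext' fun e x => by simp [sectionsRestrict_comp]

/-- The presheaf of modules `U ↦ E(U) ⊗_K S(U)`. -/
noncomputable def tensorPresheaf : PresheafOfModules.{u} R.obj where
  obj U := ModuleCat.of (R.obj.obj U) (E.val.obj U ⊗[K] S.obj U)
  map {U V} f := ModuleCat.ofHom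
    (Y := (ModuleCat.restrictScalars (R.obj.map f).hom).obj
      (ModuleCat.of (R.obj.obj V) (E.val.obj V ⊗[K] S.obj V)))
    { toFun := tensorRestrict K E S f
      map_add' := map_add _
      map_smul' := tensorRestrict_smul K E S f }
  map_id U := by
    ext t
    exact LinearMap.congr_fun (tensorRestrict_id K E S U) t
  map_comp f g := by
    ext t
    exact LinearMap.congr_fun (tensorRestrict_comp K E S f g) t

variable {S S'}

lemma lTensor_smul (φ : S ⟶ S') (U : Cᵒᵖ) (r : R.obj.obj U) (t : E.val.obj U ⊗[K] S.obj U) :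
    (φ.app U).hom.lTensor (E.val.obj U) (r • t) = r • (φ.app U).hom.lTensor (E.val.obj U) t := by
  induction t with
  | zero => simp
  | add x y hx hy => rw [smul_add, map_add, hx, hy, map_add, smul_add]
  | tmul e x => simp [TensorProduct.smul_tmul']

lemma lTensor_comp_tensorRestrict (φ : S ⟶ S') {U V : Cᵒᵖ} (f : U ⟶ V) :
    (φ.app V).hom.lTensor (E.val.obj V) ∘ₗ tensorRestrict K E S f =
      tensorRestrict K E S' f ∘ₗ (φ.app U).hom.lTensor (E.val.obj U) :=
  TensorProduct.ext' fun e x => by simp [NatTrans.naturality_apply]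

/-- The functoriality of `E ⊗_K S` in the presheaf of `K`-modules `S`. -/
noncomputable def tensorPresheafMap (φ : S ⟶ S') :
    tensorPresheaf K E S ⟶ tensorPresheaf K E S' where
  app U := ModuleCat.ofHom
    { toFun := (φ.app U).hom.lTensor (E.val.obj U)
      map_add' := map_add _
      map_smul' := lTensor_smul K E φ U }
  naturality {U V} f := by
    ext t
    exact LinearMap.congr_fun (lTensor_comp_tensorRestrict K E φ f) t

/-- Two morphisms from `E ⊗_K S` coincide if they do on elements `e ⊗ x`. -/
lemma tensorPresheaf_hom_ext {P : PresheafOfModules.{u} R.obj} {α β : tensorPresheaf K E S ⟶ P}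
    (h : ∀ (U : Cᵒᵖ) (e : E.val.obj U) (x : S.obj U),
      α.app U (e ⊗ₜ[K] x : E.val.obj U ⊗[K] S.obj U) =
        β.app U (e ⊗ₜ[K] x : E.val.obj U ⊗[K] S.obj U)) : α = β := by
  ext U t
  refine TensorProduct.induction_on (motive := fun t => α.app U t = β.app U t) t
    ((map_zero (α.app U).hom).trans (map_zero (β.app U).hom).symm) (h U) fun x y hx hy =>
      (map_add (α.app U).hom x y).trans ((congrArg₂ (· + ·) hx hy).trans
        (map_add (β.app U).hom x y).symm)

end

/-- The functor `S ↦ E ⊗_K S` from presheaves of `K`-modules to presheaves of modules. -/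
noncomputable def tensorPresheafFunctor (E : SheafOfModules.{u} R) :
    (Cᵒᵖ ⥤ ModuleCat.{u} K) ⥤ PresheafOfModules.{u} R.obj where
  obj S := tensorPresheaf K E S
  map φ := tensorPresheafMap K E φ
  map_id _ := tensorPresheaf_hom_ext K E fun _ _ _ => rfl
  map_comp _ _ := tensorPresheaf_hom_ext K E fun _ _ _ => rfl

section Over

variable {E G : SheafOfModules.{u} R} {U : C}

/-- The action of a homomorphism `φ : E|_U ⟶ G|_U` on the sections over `W → U`. -/
noncomputable def overApp (φ : E.over U ⟶ G.over U) (W : Over U) :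
    E.val.obj (op W.left) →ₗ[R.obj.obj (op W.left)] G.val.obj (op W.left) :=
  (φ.val.app (op W)).hom

lemma overApp_restrict (φ : E.over U ⟶ G.over U) {W W' : Over U} (p : W' ⟶ W)
    (e : E.val.obj (op W.left)) :
    overApp φ W' (sectionsRestrict K E p.left.op e) =
      sectionsRestrict K G p.left.op (overApp φ W e) :=
  PresheafOfModules.naturality_apply φ.val p.op e

lemma over_hom_ext {φ ψ : E.over U ⟶ G.over U} (h : ∀ W e, overApp φ W e = overApp ψ W e) :
    φ = ψ := by
  refine SheafOfModules.hom_ext (PresheafOfModules.hom_ext fun W => ?_)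
  ext e
  exact h W.unop e

lemma overApp_add (φ ψ : E.over U ⟶ G.over U) (W : Over U) (e : E.val.obj (op W.left)) :
    overApp (φ + ψ) W e = overApp φ W e + overApp ψ W e := rfl

lemma overApp_smul (c : K) (φ : E.over U ⟶ G.over U) (W : Over U) (e : E.val.obj (op W.left)) :
    overApp (c • φ) W e = c • overApp φ W e := rfl

lemma overApp_restrictHom {V : C} (f : V ⟶ U) (φ : E.over U ⟶ G.over U) (W : Over V)
    (e : E.val.obj (op W.left)) :
    overApp (restrictHom f φ) W e = overApp φ ((Over.map f).obj W) e := rfl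

/-- The two objects over `U` are not syntactically equal; they are linked by a morphism whose
underlying map is an identity, and naturality of `φ` along it compares the two values. -/
lemma overApp_restrictHom_mk_id (φ : E.over U ⟶ G.over U) (W : Over U)
    (e : E.val.obj (op W.left)) :
    overApp (restrictHom W.hom φ) (Over.mk (𝟙 W.left)) e = overApp φ W e := by
  rw [overApp_restrictHom]
  let i : (Over.map W.hom).obj (Over.mk (𝟙 W.left)) ⟶ W := Over.homMk (𝟙 _)
  have hE : E.val.presheaf.map (𝟙 (op W.left)) e = e :=
    ConcreteCategory.congr_hom (E.val.presheaf.map_id (op W.left)) e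
  have hG : G.val.presheaf.map (𝟙 (op W.left)) (overApp φ W e) = overApp φ W e :=
    ConcreteCategory.congr_hom (G.val.presheaf.map_id (op W.left)) (overApp φ W e)
  exact (congrArg (overApp φ ((Over.map W.hom).obj (Over.mk (𝟙 W.left)))) hE.symm).trans
    ((PresheafOfModules.naturality_apply φ.val i.op e).trans hG)

/-- Constructor for homomorphisms `E|_U ⟶ G|_U`. -/
noncomputable def overHomMk
    (a : ∀ W : Over U, E.val.obj (op W.left) →ₗ[R.obj.obj (op W.left)] G.val.obj (op W.left))
    (ha : ∀ {W W' : Over U} (p : W' ⟶ W) (e : E.val.obj (op W.left)),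
      a W' (sectionsRestrict K E p.left.op e) = sectionsRestrict K G p.left.op (a W e)) :
    E.over U ⟶ G.over U where
  val :=
    { app := fun W => ModuleCat.ofHom (R := R.obj.obj (op W.unop.left))
        (X := E.val.obj (op W.unop.left)) (Y := G.val.obj (op W.unop.left)) (a W.unop)
      naturality := fun p => by
        ext e
        exact ha p.unop e }

end Over

section HomEquiv

variable {E G : SheafOfModules.{u} R} {S : Cᵒᵖ ⥤ ModuleCat.{u} K}

/-- The action of a morphism `α : E ⊗_K S ⟶ G` on the sections over `U`. -/
noncomputable def tensorApp (α : tensorPresheaf K E S ⟶ G.val) (U : Cᵒᵖ) :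
    E.val.obj U ⊗[K] S.obj U →ₗ[R.obj.obj U] G.val.obj U :=
  (α.app U).hom

lemma tensorApp_restrict (α : tensorPresheaf K E S ⟶ G.val) {U V : Cᵒᵖ} (f : U ⟶ V)
    (e : E.val.obj U) (x : S.obj U) :
    tensorApp K α V (sectionsRestrict K E f e ⊗ₜ S.map f x) =
      sectionsRestrict K G f (tensorApp K α U (e ⊗ₜ x)) :=
  PresheafOfModules.naturality_apply α f (e ⊗ₜ[K] x : E.val.obj U ⊗[K] S.obj U)

lemma map_over_hom_apply (S : Cᵒᵖ ⥤ ModuleCat.{u} K) {U : C} {W W' : Over U} (p : W' ⟶ W)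
    (x : S.obj (op U)) : S.map W'.hom.op x = S.map p.left.op (S.map W.hom.op x) := by
  rw [← ConcreteCategory.comp_apply, ← S.map_comp, ← op_comp, Over.w]

/-- The homomorphism `E|_U ⟶ G|_U`, `e ↦ α (e ⊗ x)`. -/
noncomputable def tensorCurryApp (α : tensorPresheaf K E S ⟶ G.val) {U : C} (x : S.obj (op U)) :
    E.over U ⟶ G.over U :=
  overHomMk K
    (fun W =>
      { toFun := fun e => tensorApp K α (op W.left) (e ⊗ₜ S.map W.hom.op x)
        map_add' := fun e e' => by rw [TensorProduct.add_tmul, map_add]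
        map_smul' := fun r e => by rw [← TensorProduct.smul_tmul', map_smul, RingHom.id_apply] })
    (fun p e => (congrArg (fun y => tensorApp K α _ (sectionsRestrict K E p.left.op e ⊗ₜ y))
      (map_over_hom_apply K S p x)).trans (tensorApp_restrict K α p.left.op e _))

lemma overApp_tensorCurryApp (α : tensorPresheaf K E S ⟶ G.val) {U : C} (x : S.obj (op U))
    (W : Over U) (e : E.val.obj (op W.left)) :
    overApp (tensorCurryApp K α x) W e = tensorApp K α (op W.left) (e ⊗ₜ S.map W.hom.op x) := rfl

/-- The morphism `S ⟶ 𝓗om(E, G)` corresponding to `α : E ⊗_K S ⟶ G`. -/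
noncomputable def tensorCurry (α : tensorPresheaf K E S ⟶ G.val) : S ⟶ homPresheaf K E G where
  app U := ModuleCat.ofHom
    { toFun := fun x => tensorCurryApp K α x
      map_add' := fun x y => over_hom_ext fun W e => by
        rw [overApp_add, overApp_tensorCurryApp, map_add, TensorProduct.tmul_add, map_add]
        rfl
      map_smul' := fun c x => over_hom_ext fun W e => by
        -- `tensorApp` is linear over the ring of sections, so the scalar `c` has to pass through
        -- its image in that ring.
        rw [RingHom.id_apply, overApp_smul, overApp_tensorCurryApp, overApp_tensorCurryApp,
          map_smul, TensorProduct.tmul_smul, ← algebraMap_smul (R.obj.obj (op W.left)) c, map_smul]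
        rfl }
  naturality {U V} f := by
    ext x
    refine over_hom_ext fun W e => ?_
    refine (congrArg (fun y => tensorApp K α (op W.left) (e ⊗ₜ y)) ?_ :)
    exact (ConcreteCategory.congr_hom (S.map_comp f W.hom.op) x).symm

/-- The linear map `E(U) ⊗_K S(U) → G(U)` corresponding to `β : S ⟶ 𝓗om(E, G)`. -/
noncomputable def tensorUncurryApp (β : S ⟶ homPresheaf K E G) (U : Cᵒᵖ) :
    E.val.obj U ⊗[K] S.obj U →ₗ[K] G.val.obj U :=
  TensorProduct.lift
    (LinearMap.mk₂ K (fun (e : E.val.obj U) (x : S.obj U) =>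
          overApp (β.app U x : E.over U.unop ⟶ G.over U.unop) (Over.mk (𝟙 U.unop)) e)
      (fun _ _ _ => map_add _ _ _)
      (fun c e x => map_smul (overApp (β.app U x : E.over U.unop ⟶ G.over U.unop) _)
        (algebraMap K (R.obj.obj U) c) e)
      (fun e x y => by rw [map_add]; rfl)
      (fun c e x => by rw [map_smul]; rfl))

lemma tensorUncurryApp_tmul (β : S ⟶ homPresheaf K E G) (U : Cᵒᵖ) (e : E.val.obj U)
    (x : S.obj U) : tensorUncurryApp K β U (e ⊗ₜ x) =
      overApp (β.app U x : E.over U.unop ⟶ G.over U.unop) (Over.mk (𝟙 U.unop)) e := rfl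

lemma tensorUncurryApp_smul (β : S ⟶ homPresheaf K E G) (U : Cᵒᵖ) (r : R.obj.obj U)
    (t : E.val.obj U ⊗[K] S.obj U) :
    tensorUncurryApp K β U (r • t) = r • tensorUncurryApp K β U t := by
  induction t with
  | zero => simp
  | add x y hx hy => rw [smul_add, map_add, hx, hy, map_add, smul_add]
  | tmul e x =>
    rw [TensorProduct.smul_tmul', tensorUncurryApp_tmul, tensorUncurryApp_tmul]
    exact map_smul _ _ _

lemma tensorUncurryApp_restrict (β : S ⟶ homPresheaf K E G) {U V : Cᵒᵖ} (f : U ⟶ V) :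
    tensorUncurryApp K β V ∘ₗ tensorRestrict K E S f =
      sectionsRestrict K G f ∘ₗ tensorUncurryApp K β U := by
  refine TensorProduct.ext' fun e x => ?_
  change overApp (β.app V (S.map f x) : E.over V.unop ⟶ G.over V.unop) (Over.mk (𝟙 V.unop))
    (sectionsRestrict K E f e) = sectionsRestrict K G f
      (overApp (β.app U x : E.over U.unop ⟶ G.over U.unop) (Over.mk (𝟙 U.unop)) e)
  have h : (β.app V (S.map f x) : E.over V.unop ⟶ G.over V.unop) =
      restrictHom f.unop (β.app U x : E.over U.unop ⟶ G.over U.unop) :=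
    NatTrans.naturality_apply β f x
  rw [h]
  refine (overApp_restrictHom_mk_id _ (Over.mk f.unop) _).trans ?_
  exact overApp_restrict K (β.app U x : E.over U.unop ⟶ G.over U.unop)
    (Over.homMk f.unop : Over.mk f.unop ⟶ Over.mk (𝟙 U.unop)) e

/-- The morphism `E ⊗_K S ⟶ G` corresponding to `β : S ⟶ 𝓗om(E, G)`. -/
noncomputable def tensorUncurry (β : S ⟶ homPresheaf K E G) : tensorPresheaf K E S ⟶ G.val where
  app U := ModuleCat.ofHom
    { toFun := tensorUncurryApp K β U
      map_add' := map_add _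
      map_smul' := tensorUncurryApp_smul K β U }
  naturality {U V} f := by
    ext t
    exact LinearMap.congr_fun (tensorUncurryApp_restrict K β f) t

/-- Morphisms `E ⊗_K S ⟶ G` correspond to morphisms `S ⟶ 𝓗om(E, G)`. -/
noncomputable def tensorHomEquiv :
    (tensorPresheaf K E S ⟶ G.val) ≃ (S ⟶ homPresheaf K E G) where
  toFun := tensorCurry K
  invFun := tensorUncurry K
  left_inv α := tensorPresheaf_hom_ext K E fun U e x =>
    (congrArg (fun y => tensorApp K α U (e ⊗ₜ y))
      (ConcreteCategory.congr_hom (S.map_id U) x) :)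
  right_inv β := by
    ext U x
    refine over_hom_ext fun W e => ?_
    change overApp (β.app (op W.left) (S.map W.hom.op x) : E.over W.left ⟶ G.over W.left)
      (Over.mk (𝟙 W.left)) e = overApp (β.app U x : E.over U.unop ⟶ G.over U.unop) W e
    have h : (β.app (op W.left) (S.map W.hom.op x) : E.over W.left ⟶ G.over W.left) =
        restrictHom W.hom (β.app U x : E.over U.unop ⟶ G.over U.unop) :=
      NatTrans.naturality_apply β W.hom.op x
    rw [h]
    exact overApp_restrictHom_mk_id _ W e

end HomEquiv

end SheafOfModules

/-! ### The adjunction for sheaves, and preservation of injectives. -/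

namespace SheafOfModules

section Adjunction

variable {C : Type u} [SmallCategory C] {J : GrothendieckTopology C} {R : Sheaf J RingCat.{u}}
  (K : Type u) [Field K] [PresheafAlgebra K R.obj]

attribute [local instance] sectionsModule

/-- Sheafification is left adjoint to the inclusion of sheaves of modules into presheaves of
modules. -/
noncomputable def sheafificationForgetAdjunction (R : Sheaf J RingCat.{u}) :
    PresheafOfModules.sheafification (𝟙 R.obj) ⊣ forget R :=
  (PresheafOfModules.sheafificationAdjunction (𝟙 R.obj)).ofNatIsoRight
    -- The given right adjoint also restricts scalars along the identity of `R`; this is removed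
    -- here.
    (NatIso.ofComponents fun M => PresheafOfModules.isoMk
      (fun U => (ModuleCat.restrictScalarsId (R.obj.obj U)).app (M.val.obj U))
      (fun _ _ _ => rfl))

section

variable {E G : SheafOfModules.{u} R} {S S' : Sheaf J (ModuleCat.{u} K)}

/-- Homomorphisms from the sheafification of `E ⊗_K S` to `G` correspond to morphisms
`S ⟶ 𝓗om(E, G)`. -/
noncomputable def tensorSheafHomEquiv (E G : SheafOfModules.{u} R)
    (S : Sheaf J (ModuleCat.{u} K)) :
    ((PresheafOfModules.sheafification (𝟙 R.obj)).obj (tensorPresheaf K E S.obj) ⟶ G) ≃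
      (S ⟶ homSheaf K E G) :=
  ((sheafificationForgetAdjunction R).homEquiv (tensorPresheaf K E S.obj) G).trans
    ((tensorHomEquiv K (E := E) (G := G) (S := S.obj)).trans
      { toFun := fun β => ⟨β⟩
        invFun := fun β => β.hom
        left_inv := fun _ => rfl
        right_inv := fun _ => rfl })

lemma tensorUncurry_comp (φ : S.obj ⟶ S'.obj) (β : S'.obj ⟶ homPresheaf K E G) :
    tensorUncurry K (φ ≫ β) = tensorPresheafMap K E φ ≫ tensorUncurry K β :=
  tensorPresheaf_hom_ext K E fun _ _ _ => rfl

lemma tensorSheafHomEquiv_symm_comp (φ : S ⟶ S') (β : S' ⟶ homSheaf K E G) :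
    (tensorSheafHomEquiv K E G S).symm (φ ≫ β) =
      (PresheafOfModules.sheafification (𝟙 R.obj)).map (tensorPresheafMap K E φ.hom) ≫
        (tensorSheafHomEquiv K E G S').symm β :=
  (congrArg ((sheafificationForgetAdjunction R).homEquiv _ G).symm
    (tensorUncurry_comp K φ.hom β.hom)).trans
    ((sheafificationForgetAdjunction R).homEquiv_naturality_left_symm
      (tensorPresheafMap K E φ.hom) (tensorUncurry K β.hom))

lemma tensorCurry_comp {G' : SheafOfModules.{u} R} (α : tensorPresheaf K E S.obj ⟶ G.val)
    (g : G ⟶ G') :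
    tensorCurry K (α ≫ g.val) = tensorCurry K α ≫ (homSheafMap K (𝟙 E) g).hom := by
  ext U x
  exact over_hom_ext fun W e => rfl

lemma tensorSheafHomEquiv_comp {G' : SheafOfModules.{u} R}
    (α : (PresheafOfModules.sheafification (𝟙 R.obj)).obj (tensorPresheaf K E S.obj) ⟶ G)
    (g : G ⟶ G') :
    tensorSheafHomEquiv K E G' S (α ≫ g) =
      tensorSheafHomEquiv K E G S α ≫ homSheafMap K (𝟙 E) g :=
  Sheaf.hom_ext <|
    (congrArg (tensorCurry K)
      ((sheafificationForgetAdjunction R).homEquiv_naturality_right α g)).trans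
      (tensorCurry_comp K _ g)

end

/-- The functor `S ↦ E ⊗_K S` from sheaves of `K`-modules to sheaves of modules. -/
noncomputable def tensorFunctor (E : SheafOfModules.{u} R) :
    Sheaf J (ModuleCat.{u} K) ⥤ SheafOfModules.{u} R where
  obj S := (PresheafOfModules.sheafification (𝟙 R.obj)).obj (tensorPresheaf K E S.obj)
  map φ := (PresheafOfModules.sheafification (𝟙 R.obj)).map (tensorPresheafMap K E φ.hom)
  map_id S := (PresheafOfModules.sheafification (𝟙 R.obj)).congr_map
    ((tensorPresheafFunctor K E).map_id S.obj) |>.trans (CategoryTheory.Functor.map_id _ _)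
  map_comp φ ψ := (PresheafOfModules.sheafification (𝟙 R.obj)).congr_map
    ((tensorPresheafFunctor K E).map_comp φ.hom ψ.hom) |>.trans
      (CategoryTheory.Functor.map_comp _ _ _)

/-- The functor `E ⊗_K ·` is left adjoint to `𝓗om(E, ·)`. -/
noncomputable def tensorHomAdjunction (E : SheafOfModules.{u} R) :
    tensorFunctor K E ⊣ homSheafFunctor K E :=
  Adjunction.mkOfHomEquiv
    { homEquiv := fun S G => tensorSheafHomEquiv K E G S
      homEquiv_naturality_left_symm := tensorSheafHomEquiv_symm_comp K
      homEquiv_naturality_right := tensorSheafHomEquiv_comp K }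

/-- Provides the left exactness of 𝓗om(E, ·), for arbitrary `E`. -/
instance (E : SheafOfModules.{u} R) : (homSheafFunctor K E).IsRightAdjoint :=
  (tensorHomAdjunction K E).isRightAdjoint

instance (E : SheafOfModules.{u} R) : (tensorFunctor K E).PreservesMonomorphisms where
  preserves {S S'} φ hφ := by
    have h : Mono (tensorPresheafMap K E φ.hom) := by
      refine PresheafOfModules.mono_of_injective fun U => ?_
      -- Over the field `K` every module of sections of `E` is flat.
      refine Module.Flat.lTensor_preserves_injective_linearMap (M := E.val.obj U)
        (φ.hom.app U).hom ?_
      rw [← ModuleCat.mono_iff_injective]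
      exact inferInstanceAs (Mono (((sheafToPresheaf J _).map φ).app U))
    exact inferInstanceAs (Mono ((PresheafOfModules.sheafification (𝟙 R.obj)).map
      (tensorPresheafMap K E φ.hom)))

instance (E : SheafOfModules.{u} R) : (homSheafFunctor K E).PreservesInjectiveObjects :=
  Functor.preservesInjectiveObjects_of_adjunction_of_preservesMonomorphisms
    (tensorHomAdjunction K E)

instance (E : SheafOfModules.{u} R) : (homSheafFunctor K E).Linear K where
  map_smul _ _ := rfl

end Adjunction

end SheafOfModules

/-! ### Local surjectivity, and local lifting of homomorphisms out of a locally free sheaf. -/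

namespace SheafOfModules

variable {C : Type u} [SmallCategory C] {J : GrothendieckTopology C} {R : Sheaf J RingCat.{u}}

/-- An epimorphism of sheaves of modules is locally surjective. -/
lemma isLocallySurjective_of_epi {M N : SheafOfModules.{u} R} (p : M ⟶ N) [Epi p] :
    Presheaf.IsLocallySurjective J ((PresheafOfModules.toPresheaf R.obj).map p.val) := by
  let a := PresheafOfModules.sheafification (𝟙 R.obj)
  let adj := sheafificationForgetAdjunction R
  have h₁ : Epi (a.map p.val) :=
    have := Functor.PreservesEpimorphisms.of_iso (asIso adj.counit).symm
    inferInstanceAs (Epi ((forget R ⋙ a).map p))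
  -- Factor `p` through its presheaf image. The first factor is surjective on sections. The
  -- sheafified inclusion of the image is both mono and epi, hence an isomorphism, so the inclusion
  -- itself is locally surjective.
  have h₂ : a.map (Abelian.factorThruImage p.val) ≫ a.map (Abelian.image.ι p.val) =
      a.map p.val := by
    rw [← Functor.map_comp, Abelian.image.fac]
  have h₃ : Epi (a.map (Abelian.image.ι p.val)) := epi_of_epi_fac h₂
  have h₄ : IsIso (a.map (Abelian.image.ι p.val)) := isIso_of_mono_of_epi _
  have h₅ : Presheaf.IsLocallySurjective J
      ((PresheafOfModules.toPresheaf R.obj).map (Abelian.image.ι p.val)) := by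
    rw [← Presheaf.isLocallySurjective_presheafToSheaf_map_iff, Sheaf.isLocallySurjective_iff_epi']
    exact inferInstanceAs (Epi ((toSheaf R).map (a.map (Abelian.image.ι p.val))))
  have h₆ : Presheaf.IsLocallySurjective J
      ((PresheafOfModules.toPresheaf R.obj).map (Abelian.factorThruImage p.val)) :=
    Presheaf.isLocallySurjective_of_surjective J _ fun U =>
      PresheafOfModules.surjective_of_epi (Abelian.factorThruImage p.val) U
  rw [← Abelian.image.fac p.val, Functor.map_comp]
  infer_instance

/-- Over an object `U`, the global sections of a sheaf of modules are its sections over the terminal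
object `U → U`. -/
lemma sections_over_bijective {U : C} (M : SheafOfModules.{u} (R.over U)) :
    Function.Bijective fun s : M.sections => s.eval (op (Over.mk (𝟙 U))) := by
  constructor
  · intro s t h
    refine PresheafOfModules.sections_ext _ _ fun W => ?_
    let f : op (Over.mk (𝟙 U)) ⟶ W := (Over.homMk W.unop.hom : W.unop ⟶ Over.mk (𝟙 U)).op
    exact (PresheafOfModules.sections_property s f).symm.trans
      ((congrArg (M.val.map f) h).trans (PresheafOfModules.sections_property t f))
  · intro m
    refine ⟨M.val.sectionsMk
      (fun W => M.val.map (Over.homMk W.unop.hom : W.unop ⟶ Over.mk (𝟙 U)).op m) ?_, ?_⟩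
    · intro W W' f
      refine (PresheafOfModules.map_comp_apply M.val _ f m).symm.trans
        (PresheafOfModules.congr_map_apply M.val ?_ m)
      refine Quiver.Hom.unop_inj ?_
      ext
      simp
    · exact ConcreteCategory.congr_hom (M.val.presheaf.map_id (op (Over.mk (𝟙 U)))) m

section

variable [HasPullbacks C] {E : SheafOfModules.{u} R} {I : Type u} {U : C}

/-- Given a trivialization of `E` over `U`, the values on the basis of the trivialization determine
the homomorphisms `E|_V ⟶ G|_V` for every `V → U`. -/
lemma overApp_bijective_of_free (e : free I ≅ E.over U) {V : C} (f : V ⟶ U)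
    (G : SheafOfModules.{u} R) :
    Function.Bijective fun (φ : E.over V ⟶ G.over V) (i : I) =>
      overApp φ (Over.mk (𝟙 V)) (E.val.map f.op
        ((sectionsMap e.hom (freeSection i)).eval (op (Over.mk (𝟙 U))))) := by
  -- The trivialization restricted to `V`. Precomposing with it, applying the universal property of
  -- the free module and evaluating at the terminal object of `Over V` are three bijections whose
  -- composite is the map in question.
  let e' : free I ≅ E.over V := mapFreeIso (overMap R f) I (overMapUnitIso f).symm ≪≫
    (overMap R f).mapIso e ≪≫ (overFunctorMap R f).app E
  let ev := fun (s : I → (G.over V).sections) (i : I) => (s i).eval (op (Over.mk (𝟙 V)))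
  have h : (fun (φ : E.over V ⟶ G.over V) (i : I) =>
      overApp φ (Over.mk (𝟙 V)) (E.val.map f.op
        ((sectionsMap e.hom (freeSection i)).eval (op (Over.mk (𝟙 U)))))) =
      ev ∘ (G.over V).freeHomEquiv ∘ fun φ => e'.hom ≫ φ := by
    funext φ i
    let s : (E.over U).sections := sectionsMap e.hom (freeSection i)
    let r : (Over.map f).obj (Over.mk (𝟙 V)) ⟶ Over.mk (𝟙 U) := Over.homMk f
    have h₁ : E.val.map f.op (s.eval (op (Over.mk (𝟙 U)))) =
      s.eval (op ((Over.map f).obj (Over.mk (𝟙 V)))) := PresheafOfModules.sections_property s r.op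
    have h₂ : ιFree i ≫ e'.hom ≫ φ = (overMapUnitIso f).inv ≫
        (overMap R f).map (ιFree i) ≫ (overMap R f).map e.hom ≫
          (overFunctorMap R f).hom.app E ≫ φ := by
      simp only [e', Iso.trans_hom, Category.assoc]
      exact ιFree_mapFreeIso_hom_assoc (overMap R f) I (overMapUnitIso f).symm i _
    refine (congrArg (overApp φ (Over.mk (𝟙 V))) h₁).trans ?_
    exact (congrArg (fun t => ((G.over V).unitHomEquiv t).eval (op (Over.mk (𝟙 V)))) h₂).symm
  rw [h]
  refine Function.Bijective.comp ?_ ((Equiv.bijective _).comp ?_)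
  · exact Function.Bijective.piMap fun _ => sections_over_bijective _
  · exact ⟨fun _ _ h => (cancel_epi _).1 h, fun ψ => ⟨e'.inv ≫ ψ, by simp⟩⟩

variable (K : Type u) [CommRing K] [PresheafAlgebra K R.obj]

/-- If `E` is locally free of finite rank, then `𝓗om(E, ·)` preserves epimorphisms. -/
lemma preservesEpimorphisms_homSheafFunctor (hE : E.IsLocallyFreeOfFiniteRank) :
    (homSheafFunctor K E).PreservesEpimorphisms where
  preserves {G G'} p _ := by
    obtain ⟨q, hq, hq'⟩ := hE
    have hp := isLocallySurjective_of_epi p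
    suffices Sheaf.IsLocallySurjective ((homSheafFunctor K E).map p) from inferInstance
    -- It suffices to lift `φ` locally over objects that map to a trivializing `q.X i`.
    have hloc : ∀ (V : C) (i : q.I) (f : V ⟶ q.X i) (φ : E.over V ⟶ G'.over V),
      Presheaf.imageSieve ((homSheafFunctor K E).map p).hom (U := V) φ ∈ J V := by
      intro V i f φ
      let e : free (q.generators i).I ≅ E.over (q.X i) := asIso (q.generators i).π
      have : Finite (q.generators i).I := (hq'.isFiniteType i).finite
      let b (W : C) (g : W ⟶ q.X i) (j : (q.generators i).I) : E.val.obj (op W) :=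
        E.val.map g.op ((sectionsMap e.hom (freeSection j)).eval (op (Over.mk (𝟙 (q.X i)))))
      let c (j : (q.generators i).I) : G'.val.obj (op V) := overApp φ (Over.mk (𝟙 V)) (b V f j)
      have := Fintype.ofFinite (q.generators i).I
      let S (j : (q.generators i).I) : Sieve V :=
        Presheaf.imageSieve ((PresheafOfModules.toPresheaf R.obj).map p.val) (c j)
      -- Finite rank is used here: each value `c j` lifts on a covering sieve, and finitely many
      -- covering sieves have a covering intersection.
      have hS : Finset.univ.inf S ∈ J V :=
        Finset.inf_induction (p := fun T => T ∈ J V) (J.top_mem V)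
          (fun _ h _ h' => J.intersection_covering h h') fun j _ => hp.imageSieve_mem (c j)
      refine J.superset_covering ?_ hS
      intro W g hg
      have hg' : ∀ j, ∃ t : G.val.obj (op W), p.val.app (op W) t = G'.val.map g.op (c j) :=
        fun j => (Finset.inf_le (f := S) (Finset.mem_univ j) : Finset.univ.inf S ≤ S j) g hg
      choose t ht using hg'
      -- Lifts of the values on a basis define a homomorphism `ψ`; it lifts the restriction of `φ`
      -- because both have the same values on that basis.
      obtain ⟨ψ, hψ⟩ := (overApp_bijective_of_free e (g ≫ f) G).2 t
      refine ⟨ψ, (overApp_bijective_of_free e (g ≫ f) G').1 ?_⟩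
      funext j
      let r : (Over.map g).obj (Over.mk (𝟙 W)) ⟶ Over.mk (𝟙 V) := Over.homMk g
      have hb : b W (g ≫ f) j = E.val.map g.op (b V f j) :=
        PresheafOfModules.map_comp_apply E.val f.op g.op _
      refine (congrArg (p.val.app (op W)) (congrFun hψ j)).trans ((ht j).trans ?_)
      refine (PresheafOfModules.naturality_apply φ.val r.op (b V f j)).symm.trans ?_
      exact congrArg (overApp φ ((Over.map g).obj (Over.mk (𝟙 W)))) hb.symm
    constructor
    intro U φ
    refine J.transitive (q.coversTop U) _ fun V f hf => ?_
    obtain ⟨i, ⟨g⟩⟩ := (Sieve.mem_ofObjects_iff ..).1 hf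
    rw [Presheaf.pullback_imageSieve]
    exact hloc V i g _

end

end SheafOfModules

/-! ### Maps out of the constant sheaf as global sections. -/

section ConstantSheaf

variable {C : Type u} [SmallCategory C] {J : GrothendieckTopology C} {K : Type u} [CommRing K]

/-- The morphism from the constant sheaf `K` to `F` given by a global section of `F`. -/
noncomputable def constantSheafHom {T : C} (hT : IsTerminal T) (F : Sheaf J (ModuleCat.{u} K))
    (x : F.obj.obj (op T)) : (constantSheaf J (ModuleCat.{u} K)).obj (ModuleCat.of K K) ⟶ F :=
  ((constantSheafAdj J (ModuleCat.{u} K) hT).homEquiv _ F).symm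
    (ModuleCat.ofHom (LinearMap.toSpanSingleton K (F.obj.obj (op T)) x))

lemma constantSheafHom_bijective {T : C} (hT : IsTerminal T) (F : Sheaf J (ModuleCat.{u} K)) :
    Function.Bijective (constantSheafHom hT F) := by
  refine (Equiv.bijective _).comp (Function.Bijective.comp (f := fun x =>
    LinearMap.toSpanSingleton K (F.obj.obj (op T)) x) ModuleCat.homEquiv.symm.bijective ?_)
  exact (LinearMap.ringLmapEquivSelf K K (F.obj.obj (op T))).symm.bijective

lemma constantSheafHom_comp {T : C} (hT : IsTerminal T) {F F' : Sheaf J (ModuleCat.{u} K)}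
    (x : F.obj.obj (op T)) (f : F ⟶ F') :
    constantSheafHom hT F x ≫ f = constantSheafHom hT F' (f.hom.app (op T) x) := by
  refine ((constantSheafAdj J (ModuleCat.{u} K) hT).homEquiv_naturality_right_symm _ f).symm.trans
    (congrArg ((constantSheafAdj J (ModuleCat.{u} K) hT).homEquiv _ F').symm ?_)
  ext
  simp

end ConstantSheaf

/-! ### Vanishing of 𝓔xt and the comparison of Ext with cohomology. -/

namespace SheafOfModules

variable {C : Type u} [SmallCategory C] {J : GrothendieckTopology C} {R : Sheaf J RingCat.{u}}

/-- Restriction to a terminal object is fully faithful. -/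
lemma over_bijective {T : C} (hT : IsTerminal T) (E G : SheafOfModules.{u} R) :
    Function.Bijective fun f : E ⟶ G => Hom.over f T := by
  constructor
  · intro f g h
    refine SheafOfModules.hom_ext (PresheafOfModules.hom_ext fun U => ?_)
    ext e
    exact congrArg (fun φ => overApp φ (Over.mk (hT.from U.unop)) e) h
  · intro φ
    refine ⟨⟨{
      app := fun U => ModuleCat.ofHom (overApp φ (Over.mk (hT.from U.unop)))
      naturality := fun {U V} f => ?_ }⟩, ?_⟩
    · ext e
      exact PresheafOfModules.naturality_apply φ.val
        (Over.homMk f.unop : Over.mk (hT.from V.unop) ⟶ Over.mk (hT.from U.unop)).op e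
    · refine over_hom_ext fun W e => ?_
      obtain ⟨V, r, rfl⟩ := W.mk_surjective
      obtain rfl : r = hT.from V := hT.hom_ext _ _
      rfl

section Exact

variable (K : Type u) [Field K] [PresheafAlgebra K R.obj]

/-- If `E` is locally free of finite rank, then `𝓗om(E, ·)` is right exact. -/
lemma preservesFiniteColimits_homSheafFunctor [HasPullbacks C] {E : SheafOfModules.{u} R}
    (hE : E.IsLocallyFreeOfFiniteRank) :
    PreservesFiniteColimits (homSheafFunctor K E) :=
  have := preservesEpimorphisms_homSheafFunctor K hE
  Functor.preservesFiniteColimits_of_preservesEpimorphisms _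

/-- If `E` is locally free of finite rank, then `𝓔xt^k(E, ·)` is zero for `k > 0`. -/
lemma isZero_extSheaf [HasPullbacks C] {E : SheafOfModules.{u} R}
    (hE : E.IsLocallyFreeOfFiniteRank) (G : SheafOfModules.{u} R) {k : ℕ} (hk : 0 < k) :
    IsZero (extSheaf K k E G) :=
  have := preservesFiniteColimits_homSheafFunctor K hE
  Functor.isZero_rightDerived_obj_of_exact _ _ hk

/-- The identity of `E`, as a morphism from the constant sheaf `K` to `𝓗om(E, E)`. -/
noncomputable def homSheafUnit {T : C} (hT : IsTerminal T) (E : SheafOfModules.{u} R) :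
    (constantSheaf J (ModuleCat.{u} K)).obj (ModuleCat.of K K) ⟶ homSheaf K E E :=
  constantSheafHom hT (homSheaf K E E) (𝟙 (E.over T) : E.over T ⟶ E.over T)

lemma homSheafUnit_comp_homSheafMap {T : C} (hT : IsTerminal T) {E' E G : SheafOfModules.{u} R}
    (g : E' ⟶ E) (f : E ⟶ G) :
    homSheafUnit K hT E ≫ homSheafMap K g f =
      constantSheafHom hT (homSheaf K E' G)
        (Hom.over (g ≫ f) T : E'.over T ⟶ G.over T) := by
  have h : Hom.over g T ≫ 𝟙 (E.over T) ≫ Hom.over f T = Hom.over (g ≫ f) T := by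
    rw [Category.id_comp, ← Functor.map_comp]
  rw [← h]
  exact constantSheafHom_comp hT _ _

/-- The degree 0 case of the comparison: the composite is the morphism attached to `f`, viewed as a
global section of 𝓗om(E, G). -/
lemma homSheafUnit_comp_bijective {T : C} (hT : IsTerminal T) (E G : SheafOfModules.{u} R) :
    Function.Bijective fun f : E ⟶ G =>
      homSheafUnit K hT E ≫ (homSheafFunctor K E).map f := by
  have h : (fun f : E ⟶ G => homSheafUnit K hT E ≫ (homSheafFunctor K E).map f) =
      constantSheafHom hT (homSheaf K E G) ∘ fun f : E ⟶ G => Hom.over f T := by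
    funext f
    refine (homSheafUnit_comp_homSheafMap K hT (𝟙 E) f).trans ?_
    rw [Category.id_comp]
    rfl
  rw [h]
  exact (constantSheafHom_bijective hT _).comp (over_bijective hT E G)

/-- Both composites are the morphism attached to `g`, viewed as a global section of 𝓗om(E', E). This
is the hypothesis `hg` of `linearEquivMapExactFunctor_naturality`. -/
lemma homSheafUnit_naturality {T : C} (hT : IsTerminal T) {E E' : SheafOfModules.{u} R}
    (g : E' ⟶ E) :
    homSheafUnit K hT E ≫ homSheafMap K g (𝟙 E) =
      homSheafUnit K hT E' ≫ homSheafMap K (𝟙 E') g := by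
  rw [homSheafUnit_comp_homSheafMap, homSheafUnit_comp_homSheafMap, Category.comp_id,
    Category.id_comp]

/-- The functoriality of `𝓗om(E, ·)` in `E`. -/
noncomputable def homSheafFunctorMap {E E' : SheafOfModules.{u} R} (g : E' ⟶ E) :
    homSheafFunctor K E ⟶ homSheafFunctor K E' where
  app G := homSheafMap K g (𝟙 G)
  naturality _ _ _ := rfl

open Abelian

variable [HasPullbacks C] {E : SheafOfModules.{u} R} (hE : E.IsLocallyFreeOfFiniteRank)

/-- The isomorphism `Ext^k(E, G) ≅ H^k(𝓗om(E, G))` for `E` locally free of finite rank. -/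
noncomputable def extEquivSheafCohomology {T : C} (hT : IsTerminal T) (G : SheafOfModules.{u} R)
    (k : ℕ) : Ext E G k ≃ₗ[K] sheafCohomology (homSheaf K E G) k :=
  have := preservesFiniteColimits_homSheafFunctor K hE
  Ext.linearEquivMapExactFunctor (homSheafFunctor K E) K (homSheafUnit K hT E)
    (homSheafUnit_comp_bijective K hT E) G k

lemma extEquivSheafCohomology_naturality {T : C} (hT : IsTerminal T)
    {E' G G' : SheafOfModules.{u} R} (hE' : E'.IsLocallyFreeOfFiniteRank) (g : E' ⟶ E)
    (f : G ⟶ G') {k : ℕ} (x : Ext E G k) :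
    extEquivSheafCohomology K hE' hT G' k
        (((Ext.mk₀ g).comp x (zero_add k)).comp (Ext.mk₀ f) (add_zero k)) =
      (extEquivSheafCohomology K hE hT G k x).comp (Ext.mk₀ (homSheafMap K g f)) (add_zero k) :=
  have := preservesFiniteColimits_homSheafFunctor K hE
  have := preservesFiniteColimits_homSheafFunctor K hE'
  Ext.linearEquivMapExactFunctor_naturality K (homSheafFunctorMap K g) (homSheafUnit K hT E)
    (homSheafUnit_comp_bijective K hT E) (homSheafUnit K hT E')
    (homSheafUnit_comp_bijective K hT E') g (homSheafUnit_naturality K hT g) f x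

end Exact

end SheafOfModules

theorem mainTheorem1 (n : ℕ) (X : Type) [TopologicalSpace X]
    [ChartedSpace (EuclideanSpace ℂ (Fin n)) X]
    [IsManifold 𝓘(ℂ, EuclideanSpace ℂ (Fin n)) ω X] :
    (∀ E G : SheafOfModules.{0} (holomorphicSheaf n X),
      E.IsLocallyFreeOfFiniteRank → G.IsCoherent → ∀ k : ℕ, 0 < k →
        IsZero (SheafOfModules.extSheaf ℂ k E G) ∧ Subsingleton (vertexOperators ℂ k E G)) ∧
    (∀ k : ℕ, ∃ φ : ∀ E G : SheafOfModules.{0} (holomorphicSheaf n X),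
      E.IsLocallyFreeOfFiniteRank → G.IsCoherent →
        (Abelian.Ext E G k ≃ₗ[ℂ] sheafCohomology (SheafOfModules.homSheaf ℂ E G) k),
      ∀ (E E' G G' : SheafOfModules.{0} (holomorphicSheaf n X))
        (hE : E.IsLocallyFreeOfFiniteRank) (hE' : E'.IsLocallyFreeOfFiniteRank)
        (hG : G.IsCoherent) (hG' : G'.IsCoherent) (g : E' ⟶ E) (f : G ⟶ G')
        (x : Abelian.Ext E G k),
        φ E' G' hE' hG' (((Abelian.Ext.mk₀ g).comp x (zero_add k)).comp
            (Abelian.Ext.mk₀ f) (add_zero k)) =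
          (φ E G hE hG x).comp
            (Abelian.Ext.mk₀ (SheafOfModules.homSheafMap ℂ g f)) (add_zero k)) := by
  -- The whole space is the terminal object of the site of open sets, so global sections are
  -- sections over `⊤`.
  refine ⟨fun E G hE _ k hk => ?_, fun k => ⟨fun E G hE _ =>
    SheafOfModules.extEquivSheafCohomology ℂ hE isTerminalTop G k, fun E E' G G' hE hE' _ _ g f x =>
    SheafOfModules.extEquivSheafCohomology_naturality ℂ hE isTerminalTop hE' g f x⟩⟩
  have h : IsZero (SheafOfModules.extSheaf ℂ k E G) :=
    SheafOfModules.isZero_extSheaf ℂ hE G hk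
  have (q : ℕ) : Subsingleton (sheafCohomology (SheafOfModules.extSheaf ℂ k E G) q) :=
    subsingleton_of_forall_eq 0 fun x => by
      -- A class with values in a zero object is its own composite with the identity of that object,
      -- which is zero.
      rw [← x.comp_mk₀_id, h.eq_zero_of_tgt (𝟙 _), Abelian.Ext.mk₀_zero, Abelian.Ext.comp_zero]
  exact ⟨h, inferInstance⟩
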